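/- For $1<p<\infty$ let $X^p(\mathbb{R}_+)$ be the space of measurable functions $f:\mathbb{R}_+\to\mathbb{C}$, $\mathbb{R}_+=(0,\infty)$, with $\|f\|_{X^p}=\left(\int_0^\infty |f(x)|^p\,\frac{dx}{x}\right)^{1/p}<\infty$ (functions equal almost everywhere being identified), and let $\Theta=x\frac{d}{dx}$ be the infinitesimal generator of the group $U(t)f(x)=f(e^t x)$, $t\in\mathbb{R}$, in $X^p(\mathbb{R}_+)$, i.e. $\Theta f=\lim_{t\to0}(U(t)f-f)/t$ in the norm of $X^p(\mathbb{R}_+)$. For $\sigma>0$ the Bernstein space $\mathbf{B}_\sigma^p(\Theta)$ is the set of all $f\in X^p(\mathbb{R}_+)$ that belong to the domain of every power $\Theta^k$ and satisfy $\|\Theta^k f\|_{X^p}\le\sigma^k\|f\|_{X^p}$ for all $k\in\mathbb{N}$. Put $\operatorname{sinc}(u)=\frac{\sin \pi u}{\pi u}$ for $u\ne0$ and $\operatorname{sinc}(0)=1$. Theorem. Let $\sigma>0$, $1<p<\infty$ and $f\in\mathbf{B}_\sigma^p(\Theta)$. Then $f$ has a continuous representative on $\mathbb{R}_+$, which is infinitely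 differentiable; denoting it again by $f$, for all $\tau\in\mathbb{R}_+$ $$f(\tau)=\operatorname{sinc}\left(\frac{\sigma}{\pi}\ln\tau\right)f(1)+\ln\tau\,\operatorname{sinc}\left(\frac{\sigma}{\pi}\ln\tau\right)(\partial_x f)(1)+\sum_{k\in\mathbb{Z}\setminus\{0\}}f\left(e^{k\pi/\sigma}\right)\frac{\sigma}{k\pi}\,(\ln\tau)\,\operatorname{sinc}\left(\frac{\sigma}{\pi}\ln\tau-k\right).$$ The series converges absolutely, and it and the series of the absolute values of its terms converge uniformly on compact subsets of $\mathbb{R}_+$. -/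

import Mathlib

open MeasureTheory Set Filter Topology
open scoped ENNReal ContDiff

noncomputable section

namespace Mellin

/-- Lebesgue measure on the half-line `(0, ∞)`. A function on the half-line is represented by a
function `ℝ → ℂ` whose values off `(0, ∞)` are irrelevant. -/
def halfLine : Measure ℝ := volume.restrict (Ioi 0)

/-- `x ↦ x ^ (-1/p) * f x`. -/
def weighted (p : ℝ) (f : ℝ → ℂ) : ℝ → ℂ := fun x => ((x ^ (-1 / p) : ℝ) : ℂ) * f x

/-- `f` belongs to `X^p(0, ∞)`, for finite `p`. -/
def MemX (p : ℝ) (f : ℝ → ℂ) : Prop := MemLp (weighted p f) (ENNReal.ofReal p) halfLine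

/-- The norm of `X^p(0, ∞)`, for finite `p`, with values in `[0, ∞]`. -/
def xNorm (p : ℝ) (f : ℝ → ℂ) : ℝ≥0∞ := eLpNorm (weighted p f) (ENNReal.ofReal p) halfLine

/-- The Mellin translation `(U(t) f)(x) = f (e^t x)`. -/
def translate (t : ℝ) (f : ℝ → ℂ) : ℝ → ℂ := fun x => f (Real.exp t * x)

/-- `f` lies in the domain of the infinitesimal generator `Θ = x d/dx` of the group `U(t)` on
`X^p(0, ∞)`, and `Θ f = g` (as elements of that space, i.e. almost everywhere):
the difference quotients `(U(t) f - f) / t` tend to `g` in the norm of `X^p` as `t → 0`. -/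
def IsTheta (p : ℝ) (f g : ℝ → ℂ) : Prop :=
  MemX p f ∧ MemX p g ∧
    Tendsto (fun t : ℝ => xNorm p (fun x => (translate t f x - f x) / (t : ℂ) - g x))
      (𝓝[≠] 0) (𝓝 0)

/-- The Bernstein space `B_σ^p(Θ)`: all `f` in the domain of every power of `Θ` such that
`‖Θ^k f‖ ≤ σ^k ‖f‖` for all `k`. The function `g k` is `Θ^k f`, which is unique up to
almost everywhere equality. -/
def bernstein (σ p : ℝ) : Set (ℝ → ℂ) :=
  {f | ∃ g : ℕ → ℝ → ℂ, g 0 = f ∧ (∀ k, IsTheta p (g k) (g (k + 1))) ∧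
    ∀ k, xNorm p (g k) ≤ ENNReal.ofReal (σ ^ k) * xNorm p f}

/-- The normalized cardinal sine: `sin (π x) / (π x)`, with value `1` at `0`. -/
def nsinc (x : ℝ) : ℝ := Real.sinc (Real.pi * x)

/-- The term of index `k ≠ 0` of the sampling series of `f`. -/
def vtTerm (σ : ℝ) (f : ℝ → ℂ) (k : {k : ℤ // k ≠ 0}) (τ : ℝ) : ℂ :=
  f (Real.exp ((k : ℤ) * Real.pi / σ)) *
    ((σ / ((k : ℤ) * Real.pi) * Real.log τ *
      nsinc (σ / Real.pi * Real.log τ - (k : ℤ)) : ℝ) : ℂ)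

end Mellin

end

noncomputable section

/-! The substitution x = e^t turns X^p into L^p(ℝ) and Θ into d/dt. A Bernstein function becomes
almost everywhere a smooth h with |h^(k)| ≤ M σ^k (`exists_derivGrowth_of_mem_bernstein`), and
dilation by π/σ reduces to σ = π and samples at the integers.

For g integrable with Fourier transform vanishing off (-1/2, 1/2), the formula comes from expanding
e^{2πitx} - t sinc(t) 2πix in a Fourier series on [-1/2, 1/2], multiplying by 𝓕 g and integrating
(`hasSum_samplingCoeff_of_fourier_eq_zero`). The linear term makes the periodic extension continuous
and the coefficients O(1/k²); under Fourier inversion it produces the term with g'(0).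

A bounded v of type π need not be integrable, so it is replaced by v(rt) s((1-r)t)², which decays
like t⁻² and has type rπ + 2(1-r) < π. Dominated convergence as r → 1 gives `hasSum_samplingCoeff`.
-/

namespace Mellin

/-! ### Geometric derivative bounds under products and dilations -/

/-- `u` is smooth and its derivatives grow at most like `a ^ k`, up to a polynomial factor in `k`,
with the decay of `w` on the line. -/
structure DerivGrowth (u : ℝ → ℂ) (C a : ℝ) (m : ℕ) (w : ℝ → ℝ) : Prop where
  contDiff : ContDiff ℝ ∞ u
  bound : ∀ (k : ℕ) (t : ℝ), ‖iteratedDeriv k u t‖ ≤ C * w t * ((k + 1) ^ m * a ^ k)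

theorem iteratedDeriv_eq_of_hasDerivAt {w : ℕ → ℝ → ℂ}
    (hw : ∀ k t, HasDerivAt (w k) (w (k + 1) t) t) (k : ℕ) : iteratedDeriv k (w 0) = w k := by
  induction k with
  | zero => simp
  | succ k ih =>
    rw [iteratedDeriv_succ, ih]
    exact funext fun t => (hw k t).deriv

theorem contDiff_of_hasDerivAt {w : ℕ → ℝ → ℂ}
    (hw : ∀ k t, HasDerivAt (w k) (w (k + 1) t) t) : ContDiff ℝ ∞ (w 0) := by
  refine contDiff_of_differentiable_iteratedDeriv fun m _ => ?_
  rw [iteratedDeriv_eq_of_hasDerivAt hw]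
  exact fun t => (hw m t).differentiableAt

/-- The Leibniz rule and the binomial expansion of (a + b)^k have the same coefficients, so
exponential types add. -/
theorem DerivGrowth.mul {u v : ℝ → ℂ} {C D a b : ℝ} {m n : ℕ} {w z : ℝ → ℝ} (ha : 0 ≤ a)
    (hb : 0 ≤ b) (hu : DerivGrowth u C a m w) (hv : DerivGrowth v D b n z) :
    DerivGrowth (fun t => u t * v t) (C * D) (a + b) (m + n) (fun t => w t * z t) := by
  refine ⟨hu.contDiff.mul hv.contDiff, fun k t => ?_⟩
  have hC : 0 ≤ C * w t := by simpa using (norm_nonneg _).trans (hu.bound 0 t)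
  have hD : 0 ≤ D * z t := by simpa using (norm_nonneg _).trans (hv.bound 0 t)
  have hk : ((k : ℕ) : WithTop ℕ∞) ≤ ((⊤ : ℕ∞) : WithTop ℕ∞) := by exact_mod_cast le_top
  rw [iteratedDeriv_fun_mul (hu.contDiff.of_le hk).contDiffAt (hv.contDiff.of_le hk).contDiffAt,
    add_pow a b k]
  refine (norm_sum_le _ _).trans ?_
  rw [Finset.mul_sum, Finset.mul_sum]
  refine Finset.sum_le_sum fun i hi => ?_
  have hik : i ≤ k := Nat.lt_succ_iff.mp (Finset.mem_range.mp hi)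
  have h1 : ‖iteratedDeriv i u t‖ ≤ C * w t * ((k + 1) ^ m * a ^ i) := by
    refine (hu.bound i t).trans ?_
    gcongr
  have h2 : ‖iteratedDeriv (k - i) v t‖ ≤ D * z t * ((k + 1) ^ n * b ^ (k - i)) := by
    refine (hv.bound (k - i) t).trans ?_
    gcongr
    exact Nat.sub_le k i
  rw [norm_mul, norm_mul]
  have h3 : ‖((k.choose i : ℕ) : ℂ)‖ = k.choose i := by simp
  rw [h3, mul_assoc]
  calc (k.choose i : ℝ) * (‖iteratedDeriv i u t‖ * ‖iteratedDeriv (k - i) v t‖)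
      ≤ k.choose i * ((C * w t * ((k + 1) ^ m * a ^ i)) *
          (D * z t * ((k + 1) ^ n * b ^ (k - i)))) := by gcongr
    _ = _ := by rw [pow_add]; ring

theorem DerivGrowth.comp_const_mul {u : ℝ → ℂ} {C a : ℝ} {m : ℕ} {w : ℝ → ℝ}
    (hu : DerivGrowth u C a m w) {c : ℝ} (hc : 0 ≤ c) :
    DerivGrowth (fun t => u (c * t)) C (c * a) m (fun t => w (c * t)) := by
  refine ⟨hu.contDiff.comp (by fun_prop), fun k t => ?_⟩
  have hk : ((k : ℕ) : WithTop ℕ∞) ≤ ((⊤ : ℕ∞) : WithTop ℕ∞) := by exact_mod_cast le_top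
  rw [iteratedDeriv_comp_const_smul (hu.contDiff.of_le hk), norm_smul, norm_pow,
    Real.norm_of_nonneg hc]
  calc c ^ k * ‖iteratedDeriv k u (c * t)‖
      ≤ c ^ k * (C * w (c * t) * ((k + 1) ^ m * a ^ k)) := by gcongr; exact hu.bound k _
    _ = _ := by rw [mul_pow]; ring

/-! ### The decaying kernel s of type 1 -/

/-- The `j`-th derivative of `t ↦ (exp (i t) - 1) / (i t)`. -/
def expMean (j : ℕ) (t : ℝ) : ℂ :=
  ∫ x in (0 : ℝ)..1, (Complex.I * x) ^ j * Complex.exp (Complex.I * x * t)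

theorem norm_exp_I_mul_mul (x t : ℝ) : ‖Complex.exp (Complex.I * x * t)‖ = 1 := by
  rw [show Complex.I * x * t = ((x * t : ℝ) : ℂ) * Complex.I by push_cast; ring,
    Complex.norm_exp_ofReal_mul_I]

theorem norm_expMean_integrand_le (j : ℕ) (t : ℝ) {x : ℝ} (hx : x ∈ uIoc (0 : ℝ) 1) :
    ‖(Complex.I * x) ^ j * Complex.exp (Complex.I * x * t)‖ ≤ 1 := by
  rw [uIoc_of_le zero_le_one] at hx
  rw [norm_mul, norm_exp_I_mul_mul, mul_one, norm_pow, norm_mul, Complex.norm_I, one_mul,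
    Complex.norm_real, Real.norm_of_nonneg hx.1.le]
  exact pow_le_one₀ hx.1.le hx.2

theorem norm_expMean_le (j : ℕ) (t : ℝ) : ‖expMean j t‖ ≤ 1 := by
  simpa [expMean] using intervalIntegral.norm_integral_le_of_norm_le_const
    (fun x hx => norm_expMean_integrand_le j t hx)

theorem hasDerivAt_expMean (j : ℕ) (t : ℝ) : HasDerivAt (expMean j) (expMean (j + 1) t) t := by
  refine (intervalIntegral.hasDerivAt_integral_of_dominated_loc_of_deriv_le
    (F := fun (t x : ℝ) => (Complex.I * x) ^ j * Complex.exp (Complex.I * x * t))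
    (F' := fun (t x : ℝ) => (Complex.I * x) ^ (j + 1) * Complex.exp (Complex.I * x * t))
    (bound := fun _ => 1) univ_mem ?_ ?_ ?_ ?_ ?_ ?_).2
  · exact Eventually.of_forall fun s => (by fun_prop : Continuous fun x : ℝ =>
      (Complex.I * x) ^ j * Complex.exp (Complex.I * x * s)).aestronglyMeasurable
  · exact (by fun_prop : Continuous fun x : ℝ =>
      (Complex.I * x) ^ j * Complex.exp (Complex.I * x * t)).intervalIntegrable _ _
  · exact (by fun_prop : Continuous fun x : ℝ =>
      (Complex.I * x) ^ (j + 1) * Complex.exp (Complex.I * x * t)).aestronglyMeasurable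
  · exact Eventually.of_forall fun x hx s _ => norm_expMean_integrand_le (j + 1) s hx
  · simp
  · refine Eventually.of_forall fun x _ s _ => ?_
    have h := (((hasDerivAt_id s).ofReal_comp.const_mul (Complex.I * x)).cexp).const_mul
      ((Complex.I * x) ^ j)
    refine h.congr_deriv ?_
    simp only [id, Complex.ofReal_one]
    ring

theorem expMean_zero_zero : expMean 0 0 = 1 := by simp [expMean]

theorem mul_expMean_zero (t : ℝ) :
    (t : ℂ) * expMean 0 t = -Complex.I * (Complex.exp (Complex.I * t) - 1) := by
  rcases eq_or_ne t 0 with rfl | ht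
  · simp
  have hc : Complex.I * (t : ℂ) ≠ 0 := mul_ne_zero Complex.I_ne_zero (by exact_mod_cast ht)
  have h : expMean 0 t = (Complex.exp (Complex.I * t) - 1) / (Complex.I * t) := by
    have := integral_exp_mul_complex (a := 0) (b := 1) hc
    simp only [Complex.ofReal_one, mul_one, Complex.ofReal_zero, mul_zero, Complex.exp_zero] at this
    rw [← this, expMean]
    refine intervalIntegral.integral_congr fun x _ => ?_
    simp only [pow_zero, one_mul]
    congr 1
    ring
  have ht' : (t : ℂ) ≠ 0 := by exact_mod_cast ht
  rw [h]
  field_simp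
  rw [Complex.I_sq]
  ring

/-- This is `mul_expMean_zero` differentiated j + 1 times. It gives every derivative of s decay
1/|t| with a constant linear in j, which is where the polynomial factor in `DerivGrowth` originates.
-/
theorem mul_expMean_succ (j : ℕ) (t : ℝ) :
    (t : ℂ) * expMean (j + 1) t + (j + 1) * expMean j t
      = -Complex.I * (Complex.I ^ (j + 1) * Complex.exp (Complex.I * t)) := by
  have hexp : ∀ t : ℝ, HasDerivAt (fun t : ℝ => Complex.exp (Complex.I * t))
      (Complex.I * Complex.exp (Complex.I * t)) t := fun t => by
    have h := ((hasDerivAt_id t).ofReal_comp.const_mul Complex.I).cexp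
    refine h.congr_deriv ?_
    simp only [id, Complex.ofReal_one]
    ring
  induction j generalizing t with
  | zero =>
    have h1 := (hasDerivAt_id t).ofReal_comp.mul (hasDerivAt_expMean 0 t)
    have h2 := ((hexp t).sub_const 1).const_mul (-Complex.I)
    have h3 := h1.unique (h2.congr_of_eventuallyEq
      (Eventually.of_forall fun s => mul_expMean_zero s))
    simp only [id, Complex.ofReal_one] at h3
    simp only [Nat.cast_zero, zero_add, pow_one]
    rw [← h3]
    ring
  | succ j ih =>
    have h1 := ((hasDerivAt_id t).ofReal_comp.mul (hasDerivAt_expMean (j + 1) t)).add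
      ((hasDerivAt_expMean j t).const_mul ((j : ℂ) + 1))
    have h2 := ((hexp t).const_mul (Complex.I ^ (j + 1))).const_mul (-Complex.I)
    have h3 := h1.unique (h2.congr_of_eventuallyEq (Eventually.of_forall fun s => ih s))
    simp only [id, Complex.ofReal_one] at h3
    push_cast
    rw [pow_succ Complex.I (j + 1), mul_assoc (Complex.I ^ (j + 1)), ← h3]
    ring

theorem abs_mul_norm_expMean_le (j : ℕ) (t : ℝ) : |t| * ‖expMean j t‖ ≤ j + 2 := by
  have h0 : |t| * ‖expMean j t‖ = ‖(t : ℂ) * expMean j t‖ := by simp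
  rw [h0]
  cases j with
  | zero =>
    rw [mul_expMean_zero, norm_mul, norm_neg, Complex.norm_I, one_mul]
    refine (norm_sub_le _ _).trans ?_
    rw [Complex.norm_exp_I_mul_ofReal, norm_one]
    norm_num
  | succ j =>
    rw [eq_sub_of_add_eq (mul_expMean_succ j t)]
    refine (norm_sub_le _ _).trans ?_
    have h1 : ‖-Complex.I * (Complex.I ^ (j + 1) * Complex.exp (Complex.I * t))‖ = 1 := by
      rw [norm_mul, norm_mul, Complex.norm_exp_I_mul_ofReal]; simp
    have h2 : ‖((j : ℂ) + 1) * expMean j t‖ ≤ j + 1 := by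
      have : ‖(j : ℂ) + 1‖ = j + 1 := by
        exact_mod_cast Complex.norm_natCast (j + 1)
      rw [norm_mul, this]
      exact mul_le_of_le_one_right (by positivity) (norm_expMean_le j t)
    push_cast
    linarith

theorem derivGrowth_expMean : DerivGrowth (expMean 0) 3 1 1 (fun t => (1 + |t|)⁻¹) := by
  refine ⟨contDiff_of_hasDerivAt hasDerivAt_expMean, fun k t => ?_⟩
  rw [iteratedDeriv_eq_of_hasDerivAt hasDerivAt_expMean, one_pow, mul_one, pow_one]
  have hpos : 0 < 1 + |t| := by positivity
  have h1 := norm_expMean_le k t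
  have h2 := abs_mul_norm_expMean_le k t
  rw [show (3 : ℝ) * (1 + |t|)⁻¹ * ((k : ℝ) + 1) = (3 * ((k : ℝ) + 1)) / (1 + |t|) by
    field_simp, le_div_iff₀ hpos]
  have : (0 : ℝ) ≤ k := Nat.cast_nonneg k
  nlinarith

/-! ### Fourier support from derivative growth -/

open FourierTransform in
theorem norm_fourier_le_integral_norm (f : ℝ → ℂ) (ξ : ℝ) : ‖𝓕 f ξ‖ ≤ ∫ x, ‖f x‖ :=
  VectorFourier.norm_fourierIntegral_le_integral_norm _ _ _ f ξ

theorem DerivGrowth.integrable_iteratedDeriv {u : ℝ → ℂ} {C a : ℝ} {m : ℕ} {w : ℝ → ℝ}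
    (hu : DerivGrowth u C a m w) (hw : Integrable w) (k : ℕ) : Integrable (iteratedDeriv k u) := by
  refine Integrable.mono' ((hw.const_mul C).mul_const ((k + 1) ^ m * a ^ k)) ?_
    (Eventually.of_forall fun t => hu.bound k t)
  exact (hu.contDiff.continuous_iteratedDeriv k (by exact_mod_cast le_top)).aestronglyMeasurable

open FourierTransform in
/-- An integrable function whose derivatives grow like `a ^ k` has Fourier transform supported in
`[-a / 2π, a / 2π]`. -/
theorem DerivGrowth.fourier_eq_zero {u : ℝ → ℂ} {C a : ℝ} {m : ℕ} {w : ℝ → ℝ}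
    (hu : DerivGrowth u C a m w) (hw : Integrable w) (ha : 0 ≤ a) {ξ : ℝ}
    (hξ : a < 2 * Real.pi * |ξ|) : 𝓕 u ξ = 0 := by
  set b : ℝ := 2 * Real.pi * |ξ| with hb
  have hb0 : 0 < b := ha.trans_lt hξ
  -- The transform of the k-th derivative is (2πiξ)^k 𝓕 u(ξ) and is bounded by an L¹ norm. As a/b <
  -- 1, letting k → ∞ forces 𝓕 u(ξ) = 0.
  have key : ∀ k : ℕ, ‖𝓕 u ξ‖ ≤ (∫ t, C * w t) * (((k : ℝ) + 1) ^ m * (a / b) ^ k) := fun k => by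
    have h1 := congrFun (Real.fourier_iteratedDeriv (N := ⊤) (n := k) hu.contDiff
      (fun n _ => hu.integrable_iteratedDeriv hw n) le_top) ξ
    have h2 : ‖𝓕 (iteratedDeriv k u) ξ‖ ≤ (∫ t, C * w t) * (((k : ℝ) + 1) ^ m * a ^ k) := by
      refine (norm_fourier_le_integral_norm _ _).trans ?_
      rw [← integral_mul_const]
      exact integral_mono (hu.integrable_iteratedDeriv hw k).norm
        ((hw.const_mul C).mul_const _) (fun t => hu.bound k t)
    have h3 : ‖(2 * (Real.pi : ℂ) * Complex.I * ξ) ^ k‖ = b ^ k := by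
      rw [norm_pow, hb]
      simp [abs_of_pos Real.pi_pos]
    rw [h1, norm_smul, h3] at h2
    rw [div_pow, ← mul_div_assoc, ← mul_div_assoc, le_div_iff₀ (by positivity), mul_comm]
    exact h2
  have hlt : |a / b| < 1 := by
    rw [abs_of_nonneg (by positivity), div_lt_one hb0]; exact hξ
  have hlim : Tendsto (fun k : ℕ => (∫ t, C * w t) * (((k : ℝ) + 1) ^ m * (a / b) ^ k)) atTop
      (𝓝 0) := by
    rcases ha.eq_or_lt with rfl | ha'
    · refine tendsto_const_nhds.congr' ?_
      filter_upwards [eventually_ge_atTop 1] with k hk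
      simp [zero_pow (Nat.one_le_iff_ne_zero.mp hk)]
    have h := ((tendsto_pow_const_mul_const_pow_of_abs_lt_one m hlt).comp
      (tendsto_add_atTop_nat 1)).const_mul ((∫ t, C * w t) * (a / b)⁻¹)
    rw [mul_zero] at h
    refine h.congr fun k => ?_
    have : a / b ≠ 0 := by positivity
    simp only [Function.comp_apply, pow_succ (a / b)]
    push_cast
    field_simp
  have := ge_of_tendsto' hlim key
  exact norm_eq_zero.mp (le_antisymm this (norm_nonneg _))

/-! ### Cardinal sine and sampling coefficients -/

theorem mul_nsinc (x : ℝ) : x * nsinc x = Real.sin (Real.pi * x) / Real.pi := by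
  rcases eq_or_ne x 0 with rfl | hx
  · simp
  rw [nsinc, Real.sinc_of_ne_zero (mul_ne_zero Real.pi_ne_zero hx)]
  field_simp

theorem abs_nsinc_le_one (x : ℝ) : |nsinc x| ≤ 1 := Real.abs_sinc_le_one _

theorem abs_mul_nsinc_le_one (x : ℝ) : |x * nsinc x| ≤ 1 := by
  rw [mul_nsinc, abs_div, abs_of_pos Real.pi_pos, div_le_one Real.pi_pos]
  exact (Real.abs_sin_le_one _).trans (by linarith [Real.pi_gt_three])

/-- Write k = t - (t - k). Together with the factor t/k this yields the 1/k² decay of the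
coefficients. -/
theorem abs_mul_abs_nsinc_sub_le (t k : ℝ) : |k| * |nsinc (t - k)| ≤ 1 + |t| := by
  have h : k * nsinc (t - k) = t * nsinc (t - k) - (t - k) * nsinc (t - k) := by ring
  rw [← abs_mul, h]
  refine (abs_sub _ _).trans ?_
  have h1 := abs_mul_nsinc_le_one (t - k)
  have h2 : |t * nsinc (t - k)| ≤ |t| := by
    rw [abs_mul]; exact mul_le_of_le_one_right (abs_nonneg _) (abs_nsinc_le_one _)
  linarith

theorem abs_div_mul_nsinc_sub_le (t : ℝ) {k : ℝ} (hk : k ≠ 0) :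
    |t / k * nsinc (t - k)| ≤ |t| * (1 + |t|) * (1 / k ^ 2) := by
  have hk' : 0 < |k| := abs_pos.mpr hk
  have h := abs_mul_abs_nsinc_sub_le t k
  rw [abs_mul, abs_div, ← sq_abs k, mul_one_div, le_div_iff₀ (by positivity)]
  calc |t| / |k| * |nsinc (t - k)| * |k| ^ 2 = |t| * (|k| * |nsinc (t - k)|) := by field_simp
    _ ≤ _ := by gcongr

/-- The coefficient of the sample at `k` in the derivative sampling series on the integers. -/
def samplingCoeff (t : ℝ) (k : ℤ) : ℝ := if k = 0 then nsinc t else t / k * nsinc (t - k)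

theorem summable_abs_samplingCoeff (t : ℝ) : Summable fun k => |samplingCoeff t k| := by
  refine Summable.of_norm_bounded_eventually
    ((Real.summable_one_div_int_pow (p := 2)).mpr one_lt_two |>.mul_left (|t| * (1 + |t|))) ?_
  filter_upwards [eventually_cofinite_ne 0] with k hk
  simpa [samplingCoeff, hk] using abs_div_mul_nsinc_sub_le t (k := k) (by exact_mod_cast hk)

/-- Uses t/k = 1 + (t - k)/k and sin(π(t - k)) = (-1)^k sin(πt). The two summands are the Fourier
coefficients of the exponential and of the linear correction. -/
theorem samplingCoeff_eq (t : ℝ) {k : ℤ} (hk : k ≠ 0) :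
    samplingCoeff t k = nsinc (t - k) + t * nsinc t * (-1) ^ k / k := by
  have hk' : (k : ℝ) ≠ 0 := by exact_mod_cast hk
  have h : (t - k) * nsinc (t - k) = (-1) ^ k * (t * nsinc t) := by
    rw [mul_nsinc, mul_nsinc, mul_sub, mul_comm Real.pi (k : ℝ), Real.sin_sub_int_mul_pi]
    ring
  rw [samplingCoeff, if_neg hk, mul_comm (t * nsinc t), ← h]
  field_simp
  ring

/-! ### Fourier series of the sampling symbol -/

theorem integral_exp_eq_nsinc (s : ℝ) :
    ∫ x in (-(1 / 2) : ℝ)..(1 / 2), Complex.exp (2 * Real.pi * Complex.I * s * x) = nsinc s := by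
  rcases eq_or_ne s 0 with rfl | hs
  · norm_num [nsinc]
  have hc : 2 * Real.pi * Complex.I * (s : ℂ) ≠ 0 := by
    simp [hs, Real.pi_ne_zero, Complex.I_ne_zero]
  have h := mul_nsinc s
  rw [integral_exp_mul_complex hc, div_eq_iff hc]
  have h2 : ((s : ℝ) : ℂ) * nsinc s = Complex.sin (Real.pi * s) / Real.pi := by
    exact_mod_cast congrArg Complex.ofReal h
  have h3 : (nsinc s : ℂ) * (2 * Real.pi * Complex.I * s)
      = 2 * Complex.I * (Real.pi * ((s : ℂ) * nsinc s)) := by ring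
  have hpi : (Real.pi : ℂ) ≠ 0 := by exact_mod_cast Real.pi_ne_zero
  rw [h3, h2, mul_div_cancel₀ _ hpi, Complex.sin]
  push_cast
  rw [show 2 * (Real.pi : ℂ) * Complex.I * s * (1 / 2) = Real.pi * s * Complex.I by ring,
    show 2 * (Real.pi : ℂ) * Complex.I * s * (-(1 / 2)) = -(Real.pi * s) * Complex.I by ring]
  linear_combination (Complex.exp (Real.pi * s * Complex.I)
    - Complex.exp (-(Real.pi * s) * Complex.I)) * Complex.I_sq

theorem exp_neg_pi_int (k : ℤ) : Complex.exp (-(k * (Real.pi * Complex.I))) = (-1 : ℂ) ^ k := by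
  rw [Complex.exp_neg, Complex.exp_int_mul, Complex.exp_pi_mul_I, ← inv_zpow]
  norm_num

theorem exp_pi_int (k : ℤ) : Complex.exp (k * (Real.pi * Complex.I)) = (-1 : ℂ) ^ k := by
  rw [Complex.exp_int_mul, Complex.exp_pi_mul_I]

theorem integral_mul_exp {k : ℤ} (hk : k ≠ 0) :
    ∫ x in (-(1 / 2) : ℝ)..(1 / 2),
      Complex.exp (-(2 * Real.pi * Complex.I * k) * x) * (2 * Real.pi * Complex.I * x)
        = -(-1) ^ k / k := by
  set c : ℂ := -(2 * Real.pi * Complex.I * k) with hc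
  have hpi : (Real.pi : ℂ) ≠ 0 := by exact_mod_cast Real.pi_ne_zero
  have hkc : (k : ℂ) ≠ 0 := by exact_mod_cast hk
  have hc0 : c ≠ 0 := by simp [hc, Real.pi_ne_zero, Complex.I_ne_zero, hk]
  have hder : ∀ x ∈ uIcc (-(1 / 2) : ℝ) (1 / 2), HasDerivAt
      (fun x : ℝ => Complex.exp (c * x) * ((x : ℂ) / c - 1 / c ^ 2) * (2 * Real.pi * Complex.I))
      (Complex.exp (c * x) * (2 * Real.pi * Complex.I * x)) x := fun x _ => by
    have h0 := (hasDerivAt_id x).ofReal_comp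
    have h := (((h0.const_mul c).cexp).mul ((h0.div_const c).sub_const (1 / c ^ 2))).mul_const
      (2 * Real.pi * Complex.I)
    refine h.congr_deriv ?_
    simp only [id, Complex.ofReal_one]
    field_simp
    ring
  rw [intervalIntegral.integral_eq_sub_of_hasDerivAt hder
    ((by fun_prop : Continuous fun x : ℝ =>
      Complex.exp (c * x) * (2 * Real.pi * Complex.I * x)).intervalIntegrable _ _)]
  push_cast
  rw [show c * (1 / 2 : ℂ) = -(k * (Real.pi * Complex.I)) by rw [hc]; ring,
    show c * (-(1 / 2) : ℂ) = k * (Real.pi * Complex.I) by rw [hc]; ring, exp_neg_pi_int,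
    exp_pi_int, hc]
  have := Complex.I_ne_zero
  field_simp
  ring

/-- The function whose Fourier coefficients on `[-1/2, 1/2]` are `samplingCoeff t`. -/
def samplingSymbol (t x : ℝ) : ℂ :=
  Complex.exp (2 * Real.pi * Complex.I * t * x)
    - (t * nsinc t : ℝ) * (2 * Real.pi * Complex.I * x)

theorem continuous_samplingSymbol (t : ℝ) : Continuous (samplingSymbol t) := by
  unfold samplingSymbol; fun_prop

/-- The exponential jumps by 2i sin(πt) between the endpoints, and so does the linear term, by
`mul_nsinc`. -/
theorem samplingSymbol_neg_half (t : ℝ) :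
    samplingSymbol t (-(1 / 2)) = samplingSymbol t (1 / 2) := by
  have h : ((t * nsinc t : ℝ) : ℂ) = Complex.sin (Real.pi * t) / Real.pi := by
    exact_mod_cast congrArg Complex.ofReal (mul_nsinc t)
  have hpi : (Real.pi : ℂ) ≠ 0 := by exact_mod_cast Real.pi_ne_zero
  rw [samplingSymbol, samplingSymbol, h, Complex.sin]
  push_cast
  rw [show 2 * (Real.pi : ℂ) * Complex.I * t * (1 / 2) = Real.pi * t * Complex.I by ring,
    show 2 * (Real.pi : ℂ) * Complex.I * t * (-(1 / 2)) = -(Real.pi * t) * Complex.I by ring]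
  field_simp
  linear_combination (2 * Complex.exp (-(Real.pi * t * Complex.I))
    - 2 * Complex.exp (Real.pi * t * Complex.I)) * Complex.I_sq

theorem integral_samplingSymbol (t : ℝ) (k : ℤ) :
    ∫ x in (-(1 / 2) : ℝ)..(1 / 2),
      Complex.exp (-(2 * Real.pi * Complex.I * k) * x) * samplingSymbol t x
        = samplingCoeff t k := by
  have h1 : ∀ x : ℝ, Complex.exp (-(2 * Real.pi * Complex.I * k) * x) * samplingSymbol t x
      = Complex.exp (2 * Real.pi * Complex.I * ((t - k : ℝ) : ℂ) * x) - (t * nsinc t : ℝ) *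
        (Complex.exp (-(2 * Real.pi * Complex.I * k) * x) * (2 * Real.pi * Complex.I * x)) := by
    intro x
    rw [samplingSymbol, mul_sub, ← Complex.exp_add]
    push_cast
    ring_nf
  simp only [h1]
  rw [intervalIntegral.integral_sub
    ((by fun_prop : Continuous _).intervalIntegrable _ _)
    ((by fun_prop : Continuous _).intervalIntegrable _ _), integral_exp_eq_nsinc,
    intervalIntegral.integral_const_mul]
  rcases eq_or_ne k 0 with rfl | hk
  · have : ∫ x in (-(1 / 2) : ℝ)..(1 / 2), (x : ℂ) = 0 := by
      rw [intervalIntegral.integral_ofReal, integral_id]; norm_num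
    simp only [Int.cast_zero, mul_zero, neg_zero, zero_mul, Complex.exp_zero, one_mul,
      intervalIntegral.integral_const_mul, this, samplingCoeff, if_true, sub_zero]
  · rw [integral_mul_exp hk, samplingCoeff_eq t hk]
    push_cast
    ring

theorem hasSum_samplingSymbol (t : ℝ) {x : ℝ} (hx : |x| < 1 / 2) :
    HasSum (fun k : ℤ => (samplingCoeff t k : ℂ) * Complex.exp (2 * Real.pi * Complex.I * k * x))
      (samplingSymbol t x) := by
  have hcont : Continuous (AddCircle.liftIco 1 (-(1 / 2) : ℝ) (samplingSymbol t)) :=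
    AddCircle.liftIco_continuous
      (by rw [samplingSymbol_neg_half]; norm_num) (continuous_samplingSymbol t).continuousOn
  have hcoeff : ∀ k, fourierCoeff (AddCircle.liftIco 1 (-(1 / 2) : ℝ) (samplingSymbol t)) k
      = samplingCoeff t k := fun k => by
    rw [fourierCoeff_liftIco_eq, fourierCoeffOn_eq_integral, ← integral_samplingSymbol]
    rw [show (-(1 / 2) + 1 : ℝ) = 1 / 2 by norm_num]
    rw [show 1 / ((1 : ℝ) / 2 - -(1 / 2)) = 1 by norm_num, one_smul]
    refine intervalIntegral.integral_congr fun x _ => ?_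
    simp only [fourier_coe_apply, smul_eq_mul]
    push_cast
    ring_nf
  have hsum : Summable (fourierCoeff (AddCircle.liftIco 1 (-(1 / 2) : ℝ) (samplingSymbol t))) := by
    refine Summable.of_norm ?_
    simp only [hcoeff, Complex.norm_real, Real.norm_eq_abs]
    exact summable_abs_samplingCoeff t
  have h := has_pointwise_sum_fourier_series_of_summable (f := ⟨_, hcont⟩) hsum
    (x : AddCircle (1 : ℝ))
  have hx' := abs_lt.mp hx
  simp only [ContinuousMap.coe_mk] at h
  rw [AddCircle.liftIco_coe_apply ⟨hx'.1.le, by linarith [hx'.2]⟩] at h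
  convert h using 2 with k
  rw [hcoeff, fourier_coe_apply, smul_eq_mul]
  simp

/-! ### Derivative sampling for integrable band-limited functions -/

open FourierTransform in
theorem continuous_fourier_of_integrable {g : ℝ → ℂ} (hg : Integrable g) : Continuous (𝓕 g) :=
  VectorFourier.fourierIntegral_continuous Real.continuous_fourierChar
    (by exact continuous_inner) hg

theorem integrable_of_continuous_of_eq_zero {A : ℝ → ℂ} (hA : Continuous A) {R : ℝ}
    (h0 : ∀ x, R ≤ |x| → A x = 0) : Integrable A := by
  refine hA.integrable_of_hasCompactSupport
    (HasCompactSupport.intro (isCompact_Icc (a := -R) (b := R)) fun x hx => h0 x ?_)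
  by_contra h
  exact hx (abs_le.mp (not_le.mp h).le)

open FourierTransform in
/-- Derivative sampling for a band-limited integrable function. -/
theorem hasSum_samplingCoeff_of_fourier_eq_zero {g : ℝ → ℂ} (hg : ContDiff ℝ 1 g)
    (hi : Integrable g) (hi' : Integrable (deriv g))
    (hF : ∀ x : ℝ, 1 / 2 ≤ |x| → 𝓕 g x = 0) (t : ℝ) :
    HasSum (fun k : ℤ => (samplingCoeff t k : ℂ) * g k)
      (g t - (t * nsinc t : ℝ) * deriv g 0) := by
  have hAc : Continuous (𝓕 g) := continuous_fourier_of_integrable hi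
  have hA : Integrable (𝓕 g) := integrable_of_continuous_of_eq_zero hAc hF
  have hd : 𝓕 (deriv g) = fun x : ℝ => (2 * Real.pi * Complex.I * x) • 𝓕 g x :=
    Real.fourier_deriv hi (hg.differentiable one_ne_zero) hi'
  have hdi : Integrable (𝓕 (deriv g)) :=
    integrable_of_continuous_of_eq_zero (R := 1 / 2) (continuous_fourier_of_integrable hi')
      fun x hx => by rw [hd]; simp [hF x hx]
  have hexp : ∀ s x : ℝ, ‖Complex.exp (2 * Real.pi * Complex.I * s * x)‖ = 1 := fun s x => by
    rw [show 2 * Real.pi * Complex.I * (s : ℂ) * x = ((2 * Real.pi * s * x : ℝ) : ℂ) * Complex.I by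
      push_cast; ring, Complex.norm_exp_ofReal_mul_I]
  have hint : ∀ s : ℝ, Integrable fun x : ℝ =>
      Complex.exp (2 * Real.pi * Complex.I * s * x) * 𝓕 g x := fun s => by
    refine hA.bdd_mul (c := 1) (by fun_prop : Continuous _).aestronglyMeasurable ?_
    exact Eventually.of_forall fun x => (hexp s x).le
  have hinv : ∀ s : ℝ, ∫ x : ℝ, Complex.exp (2 * Real.pi * Complex.I * s * x) * 𝓕 g x = g s := by
    intro s
    conv_rhs => rw [← hg.continuous.fourierInv_fourier_eq hi hA]
    rw [Real.fourierInv_eq']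
    refine integral_congr_ae (Eventually.of_forall fun x => ?_)
    simp only [smul_eq_mul, RCLike.inner_apply, conj_trivial]
    congr 2
    push_cast
    ring
  have hinv' : ∫ x : ℝ, (2 * Real.pi * Complex.I * x) * 𝓕 g x = deriv g 0 := by
    conv_rhs => rw [← (hg.continuous_deriv le_rfl).fourierInv_fourier_eq hi' hdi]
    rw [Real.fourierInv_eq', hd]
    simp
  -- Absolute summability of the coefficients permits exchanging sum and integral.
  have hsumm : Summable fun k : ℤ => ∫ x : ℝ, ‖(samplingCoeff t k : ℂ) *
      (Complex.exp (2 * Real.pi * Complex.I * (k : ℝ) * x) * 𝓕 g x)‖ := by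
    simp only [norm_mul, hexp, one_mul, integral_const_mul, Complex.norm_real, Real.norm_eq_abs]
    exact (summable_abs_samplingCoeff t).mul_right _
  have h := hasSum_integral_of_summable_integral_norm
    (fun k : ℤ => (hint k).const_mul (samplingCoeff t k : ℂ)) hsumm
  have hpt : ∀ x : ℝ, ∑' k : ℤ, (samplingCoeff t k : ℂ) *
      (Complex.exp (2 * Real.pi * Complex.I * (k : ℝ) * x) * 𝓕 g x)
        = Complex.exp (2 * Real.pi * Complex.I * t * x) * 𝓕 g x
          - (t * nsinc t : ℝ) * ((2 * Real.pi * Complex.I * x) * 𝓕 g x) := fun x => by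
    -- The Fourier series is needed only inside the open band; elsewhere 𝓕 g vanishes.
    rcases lt_or_ge |x| (1 / 2) with hx | hx
    · have h := ((hasSum_samplingSymbol t hx).mul_right (𝓕 g x)).tsum_eq
      rw [samplingSymbol, sub_mul] at h
      simpa only [mul_assoc, Complex.ofReal_intCast] using h
    · simp [hF x hx]
  have hdi'' : Integrable fun x : ℝ => (2 * Real.pi * Complex.I * x) * 𝓕 g x := by
    rw [hd] at hdi; exact hdi
  simp only [hpt] at h
  rw [integral_sub (hint t) (hdi''.const_mul _), integral_const_mul, hinv, hinv'] at h
  simpa only [integral_const_mul, hinv] using h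

/-! ### Derivative sampling for bounded functions of type π -/

/-- The decaying band-limited approximation `v (r t) s((1 - r) t) ^ 2` of `v`, where
`s t = (exp (i t) - 1) / (i t)`. -/
def bandApprox (v : ℝ → ℂ) (r t : ℝ) : ℂ :=
  v (r * t) * (expMean 0 ((1 - r) * t) * expMean 0 ((1 - r) * t))

theorem integrable_decay {c : ℝ} (hc : c ≠ 0) :
    Integrable fun t : ℝ => (1 : ℝ) * ((1 + |c * t|)⁻¹ * (1 + |c * t|)⁻¹) := by
  have h : Integrable fun t : ℝ => (1 + |t|)⁻¹ * (1 + |t|)⁻¹ := by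
    refine integrable_inv_one_add_sq.mono' (by fun_prop) (Eventually.of_forall fun t => ?_)
    rw [← mul_inv, norm_inv, Real.norm_of_nonneg (by positivity)]
    gcongr
    nlinarith [abs_nonneg t, sq_abs t]
  simpa using h.comp_mul_left' hc

theorem derivGrowth_bandApprox {v : ℝ → ℂ} {M : ℝ} (hv : DerivGrowth v M Real.pi 0 fun _ => 1)
    {r : ℝ} (h0 : 0 ≤ r) (h1 : r ≤ 1) :
    DerivGrowth (bandApprox v r) (M * (3 * 3)) (r * Real.pi + ((1 - r) * 1 + (1 - r) * 1))
      (0 + (1 + 1)) (fun t => 1 * ((1 + |(1 - r) * t|)⁻¹ * (1 + |(1 - r) * t|)⁻¹)) := by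
  have hr : 0 ≤ 1 - r := sub_nonneg.mpr h1
  have hs := derivGrowth_expMean.comp_const_mul hr
  exact (hv.comp_const_mul h0).mul (by positivity) (by positivity)
    (hs.mul (by positivity) (by positivity) hs)

theorem deriv_bandApprox_zero {v : ℝ → ℂ} (hv : Differentiable ℝ v) (r : ℝ) :
    deriv (bandApprox v r) 0 = r * deriv v 0 + v 0 * (2 * ((1 - r : ℝ) * expMean 1 0)) := by
  have hl : ∀ c : ℝ, HasDerivAt (fun t : ℝ => c * t) c 0 := fun c => by
    simpa using (hasDerivAt_id (0 : ℝ)).const_mul c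
  have h1 : HasDerivAt (fun t => v (r * t)) (r • deriv v 0) 0 :=
    HasDerivAt.scomp (0 : ℝ) (by simpa using (hv 0).hasDerivAt) (hl r)
  have h2 : HasDerivAt (fun t => expMean 0 ((1 - r) * t)) ((1 - r) • expMean 1 0) 0 :=
    HasDerivAt.scomp (g₁ := expMean 0) (0 : ℝ) (by simpa using hasDerivAt_expMean 0 0) (hl (1 - r))
  have h := (h1.mul (h2.mul h2)).deriv
  simp only [Pi.mul_apply, mul_zero, expMean_zero_zero, Complex.real_smul] at h
  refine Eq.trans h ?_
  ring_nf

/-- Derivative sampling for a function of exponential type `π` that is bounded on the line. -/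
theorem hasSum_samplingCoeff {v : ℝ → ℂ} {M : ℝ} (hv : DerivGrowth v M Real.pi 0 fun _ => 1)
    (t : ℝ) :
    HasSum (fun k : ℤ => (samplingCoeff t k : ℂ) * v k)
      (v t - (t * nsinc t : ℝ) * deriv v 0) := by
  have hbv : ∀ s, ‖v s‖ ≤ M := fun s => by simpa using hv.bound 0 s
  have hvc : Continuous v := hv.contDiff.continuous
  have hsc : Continuous (expMean 0) := derivGrowth_expMean.contDiff.continuous
  have hb : ∀ r s, ‖bandApprox v r s‖ ≤ M := fun r s => by
    have h := norm_expMean_le 0 ((1 - r) * s)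
    rw [bandApprox, norm_mul, norm_mul]
    exact (mul_le_of_le_one_right (norm_nonneg _)
      (mul_le_one₀ h (norm_nonneg _) h)).trans (hbv _)
  have hlim : ∀ s, Tendsto (fun r => bandApprox v r s) (𝓝[<] 1) (𝓝 (v s)) := fun s => by
    have hc : Continuous fun r => bandApprox v r s := by unfold bandApprox; fun_prop
    have h := (hc.tendsto 1).mono_left (nhdsWithin_le_nhds (s := Iio 1))
    simpa [bandApprox, expMean_zero_zero] using h
  have hd : Tendsto (fun r => deriv (bandApprox v r) 0) (𝓝[<] 1) (𝓝 (deriv v 0)) := by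
    simp only [deriv_bandApprox_zero (hv.contDiff.differentiable (by simp))]
    have hc : Continuous fun r : ℝ =>
        (r : ℂ) * deriv v 0 + v 0 * (2 * ((1 - r : ℝ) * expMean 1 0)) := by fun_prop
    have h := (hc.tendsto 1).mono_left (nhdsWithin_le_nhds (s := Iio 1))
    simpa using h
  have hdom : Summable fun k : ℤ => |samplingCoeff t k| * M :=
    (summable_abs_samplingCoeff t).mul_right M
  have hsummable : Summable fun k : ℤ => (samplingCoeff t k : ℂ) * v k := by
    refine Summable.of_norm_bounded hdom fun k => ?_
    rw [norm_mul, Complex.norm_real, Real.norm_eq_abs]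
    gcongr
    exact hbv _
  have hL := tendsto_tsum_of_dominated_convergence (𝓕 := 𝓝[<] (1 : ℝ)) hdom
    (f := fun r k => (samplingCoeff t k : ℂ) * bandApprox v r k)
    (fun k => (hlim k).const_mul _) (Eventually.of_forall fun r k => by
      rw [norm_mul, Complex.norm_real, Real.norm_eq_abs]
      gcongr
      exact hb r k)
  have hR := (hlim t).sub (hd.const_mul ((t * nsinc t : ℝ) : ℂ))
  have heq : ∀ᶠ r : ℝ in 𝓝[<] 1, ∑' k : ℤ, (samplingCoeff t k : ℂ) * bandApprox v r k
      = bandApprox v r t - (t * nsinc t : ℝ) * deriv (bandApprox v r) 0 := by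
    filter_upwards [Ioo_mem_nhdsLT (zero_lt_one' ℝ)] with r hr
    have hg := derivGrowth_bandApprox hv hr.1.le hr.2.le
    have hw := integrable_decay (sub_pos.mpr hr.2).ne'
    have hpi := Real.pi_gt_three
    have hi := hg.integrable_iteratedDeriv hw
    refine (hasSum_samplingCoeff_of_fourier_eq_zero (hg.contDiff.of_le (by simp))
      (by simpa using hi 0) (by simpa using hi 1) (fun x hx => ?_) t).tsum_eq
    refine hg.fourier_eq_zero hw (by nlinarith [hr.1, hr.2]) ?_
    -- Since π > 2 and r < 1, rπ + 2(1 - r) < π ≤ 2π|x|; the strict inequality covers the endpoints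
    -- |x| = 1/2.
    nlinarith [hr.1, hr.2]
  rw [← tendsto_nhds_unique (hL.congr' heq) hR]
  exact hsummable.hasSum

/-! ### The logarithmic change of variable -/

theorem ae_comp_exp {P : ℝ → Prop} (h : ∀ᵐ x ∂halfLine, P x) :
    ∀ᵐ t : ℝ, P (Real.exp t) := by
  rw [halfLine, ae_restrict_iff' measurableSet_Ioi, ae_iff] at h
  rw [ae_iff]
  refine measure_mono_null (t := Real.log '' {x | ¬(x ∈ Ioi 0 → P x)}) ?_
    (addHaar_image_eq_zero_of_differentiableOn_of_addHaar_eq_zero volume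
      (fun x hx => (Real.differentiableAt_log ?_).differentiableWithinAt) h)
  · intro t ht
    exact ⟨Real.exp t, by simpa [Real.exp_pos] using ht, Real.log_exp t⟩
  · simp only [mem_ofPred_eq, Classical.not_imp, mem_Ioi] at hx
    exact hx.1.ne'

theorem ae_comp_log {P : ℝ → Prop} (h : ∀ᵐ t : ℝ, P t) : ∀ᵐ x ∂halfLine, P (Real.log x) := by
  rw [halfLine, ae_restrict_iff' measurableSet_Ioi, ae_iff]
  rw [ae_iff] at h
  refine measure_mono_null (t := Real.exp '' {t | ¬P t}) ?_
    (addHaar_image_eq_zero_of_differentiableOn_of_addHaar_eq_zero volume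
      Real.differentiable_exp.differentiableOn h)
  intro x hx
  simp only [mem_ofPred_eq, Classical.not_imp, mem_Ioi] at hx
  exact ⟨Real.log x, hx.2, Real.exp_log hx.1⟩

theorem quasiMeasurePreserving_exp :
    Measure.QuasiMeasurePreserving Real.exp volume halfLine := by
  refine ⟨Real.measurable_exp, Measure.AbsolutelyContinuous.mk fun s hs h => ?_⟩
  rw [Measure.map_apply Real.measurable_exp hs]
  have : ∀ᵐ x ∂halfLine, x ∉ s := by rw [ae_iff]; simpa using h
  simpa [ae_iff, preimage] using ae_comp_exp this

/-- The Jacobian e^t cancels the p-th power e^{-t} of the weight. -/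
theorem xNorm_eq_eLpNorm {p : ℝ} (hp : 0 < p) (f : ℝ → ℂ) :
    xNorm p f = eLpNorm (fun t => f (Real.exp t)) (ENNReal.ofReal p) volume := by
  have hp0 : ENNReal.ofReal p ≠ 0 := by simpa using hp
  rw [xNorm, eLpNorm_eq_lintegral_rpow_enorm_toReal hp0 ENNReal.ofReal_ne_top,
    eLpNorm_eq_lintegral_rpow_enorm_toReal hp0 ENNReal.ofReal_ne_top,
    ENNReal.toReal_ofReal hp.le, halfLine, ← Real.range_exp, ← image_univ,
    lintegral_image_eq_lintegral_abs_deriv_mul MeasurableSet.univ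
      (fun x _ => (Real.hasDerivAt_exp x).hasDerivWithinAt) Real.exp_injective.injOn,
    Measure.restrict_univ]
  congr 1
  refine lintegral_congr fun t => ?_
  have h : ‖((Real.exp t ^ (-1 / p) : ℝ) : ℂ)‖ₑ ^ p = ENNReal.ofReal (Real.exp (-t)) := by
    rw [← ofReal_norm, Complex.norm_real, Real.norm_of_nonneg (by positivity),
      ENNReal.ofReal_rpow_of_nonneg (by positivity) hp.le, ← Real.exp_mul, ← Real.exp_mul]
    congr 2
    field_simp
  rw [weighted, enorm_mul, ENNReal.mul_rpow_of_nonneg _ _ hp.le, h, ← mul_assoc,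
    abs_of_pos (Real.exp_pos t), ← ENNReal.ofReal_mul (Real.exp_pos t).le, ← Real.exp_add]
  simp

theorem MemX.memLp_comp_exp {p : ℝ} (hp : 0 < p) {f : ℝ → ℂ} (hf : MemX p f) :
    MemLp (fun t => f (Real.exp t)) (ENNReal.ofReal p) volume := by
  refine ⟨?_, by rw [← xNorm_eq_eLpNorm hp]; exact hf.2⟩
  have h1 := hf.1.comp_quasiMeasurePreserving quasiMeasurePreserving_exp
  have h2 : AEStronglyMeasurable (fun t : ℝ => ((Real.exp t ^ (1 / p) : ℝ) : ℂ)) volume := by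
    refine (Measurable.aestronglyMeasurable ?_)
    fun_prop
  refine (h2.mul h1).congr (Eventually.of_forall fun t => ?_)
  simp only [Pi.mul_apply, Function.comp_apply, weighted]
  rw [← mul_assoc, ← Complex.ofReal_mul, ← Real.rpow_add (Real.exp_pos t)]
  rw [show 1 / p + -1 / p = 0 by ring, Real.rpow_zero, Complex.ofReal_one, one_mul]

/-! ### Smoothness and uniform bounds for Bernstein functions -/

theorem intervalIntegrable_of_locallyIntegrable {u : ℝ → ℂ} (hu : LocallyIntegrable u volume)
    (a b : ℝ) : IntervalIntegrable u volume a b :=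
  intervalIntegrable_iff.mpr
    ((hu.integrableOn_isCompact isCompact_uIcc).mono_set uIoc_subset_uIcc)

/-- If the difference quotients of `u` converge to `u'` in `L^p`, then `u` is almost everywhere
equal to a primitive of `u'`. -/
theorem exists_primitive_of_tendsto_eLpNorm {p : ℝ≥0∞} (hp : 1 ≤ p) {u u' : ℝ → ℂ}
    (hu : MemLp u p volume) (hu' : MemLp u' p volume)
    (h : Tendsto (fun t : ℝ => eLpNorm (fun x => (u (t + x) - u x) / (t : ℂ) - u' x) p volume)
      (𝓝[≠] 0) (𝓝 0)) :
    ∃ w : ℝ → ℂ, w =ᵐ[volume] u ∧ ∃ a, ∀ b, w b = w a + ∫ x in a..b, u' x := by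
  have hloc := hu.locallyIntegrable hp
  have hloc' := hu'.locallyIntegrable hp
  have hii := intervalIntegrable_of_locallyIntegrable hloc
  have hii' := intervalIntegrable_of_locallyIntegrable hloc'
  have hae := LocallyIntegrable.ae_hasDerivAt_integral hloc
  -- Almost every point is a differentiability point of the primitive of u, with derivative u. There
  -- the integral over [a, b] of the difference quotient is a difference of two slopes of that
  -- primitive, tending to u(b) - u(a); by Hölder on [a, b] it also tends to the integral of u'.
  have key : ∀ a b : ℝ, a ≤ b → HasDerivAt (fun x => ∫ s in (0 : ℝ)..x, u s) (u a) a →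
      HasDerivAt (fun x => ∫ s in (0 : ℝ)..x, u s) (u b) b → u b - u a = ∫ x in a..b, u' x := by
    intro a b hab ha hb
    have hlim0 : Tendsto (fun t : ℝ => ∫ x in a..b, ((u (t + x) - u x) / (t : ℂ) - u' x))
        (𝓝[≠] 0) (𝓝 0) := by
      rw [tendsto_zero_iff_enorm_tendsto_zero]
      have hfin : (volume.restrict (Ioc a b)) univ ^ (1 / (1 : ℝ≥0∞).toReal - 1 / p.toReal)
          ≠ ⊤ := by
        refine ENNReal.rpow_ne_top_of_nonneg ?_ (by rw [Measure.restrict_apply_univ]; simp)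
        rcases eq_or_ne p ⊤ with rfl | hpt
        · simp
        · have h1 : 1 ≤ p.toReal := by simpa using ENNReal.toReal_mono hpt hp
          simpa using inv_le_one_of_one_le₀ h1
      have h' := ENNReal.Tendsto.mul_const h (Or.inr hfin)
      rw [zero_mul] at h'
      refine tendsto_of_tendsto_of_tendsto_of_le_of_le tendsto_const_nhds h'
        (fun _ => zero_le) fun t => ?_
      have hm : AEStronglyMeasurable (fun x => (u (t + x) - u x) / (t : ℂ) - u' x) volume := by
        have h1 : AEStronglyMeasurable (fun x => u (t + x)) volume :=
          hu.1.comp_quasiMeasurePreserving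
            (measurePreserving_add_left volume t).quasiMeasurePreserving
        simp only [div_eq_mul_inv]
        exact ((h1.sub hu.1).mul_const ((t : ℂ)⁻¹)).sub hu'.1
      rw [intervalIntegral.integral_of_le hab]
      refine (enorm_integral_le_lintegral_enorm _).trans ?_
      rw [← eLpNorm_one_eq_lintegral_enorm]
      refine (eLpNorm_le_eLpNorm_mul_rpow_measure_univ hp hm.restrict).trans ?_
      gcongr
      exact Measure.restrict_le_self
    have hlim1 := ((hasDerivAt_iff_tendsto_slope_zero.mp hb).sub
      (hasDerivAt_iff_tendsto_slope_zero.mp ha)).sub_const (∫ x in a..b, u' x)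
    have heq : ∀ t : ℝ, t⁻¹ • ((∫ s in (0 : ℝ)..(b + t), u s) - ∫ s in (0 : ℝ)..b, u s)
        - t⁻¹ • ((∫ s in (0 : ℝ)..(a + t), u s) - ∫ s in (0 : ℝ)..a, u s)
        - (∫ x in a..b, u' x) = ∫ x in a..b, ((u (t + x) - u x) / (t : ℂ) - u' x) := fun t => by
      have hsh : IntervalIntegrable (fun x => u (t + x)) volume a b := by
        simpa using (hii (t + a) (t + b)).comp_add_left t
      rw [intervalIntegral.integral_sub ((hsh.sub (hii a b)).div_const _) (hii' a b),
        intervalIntegral.integral_div, intervalIntegral.integral_sub hsh (hii a b),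
        intervalIntegral.integral_comp_add_left (fun x => u x) t, add_comm b t, add_comm a t,
        ← intervalIntegral.integral_interval_sub_left (hii 0 b) (hii 0 a),
        ← intervalIntegral.integral_interval_sub_left (hii 0 (t + b)) (hii 0 (t + a))]
      simp only [Complex.real_smul, Complex.ofReal_inv]
      ring
    have := tendsto_nhds_unique (hlim1.congr heq) hlim0
    exact sub_eq_zero.mp this
  obtain ⟨a, ha⟩ := hae.exists
  refine ⟨fun b => u a + ∫ x in a..b, u' x, ?_, a, fun b => by simp⟩
  filter_upwards [hae] with b hb
  rcases le_total a b with hab | hab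
  · rw [← key a b hab (ha 0) (hb 0)]; ring
  · rw [intervalIntegral.integral_symm, ← key b a hab (hb 0) (ha 0)]; ring

/-- Averaging |w(t)| ≤ |w(s)| + ∫|w'| over s in an interval of length one bounds w(t) by L¹ norms
there, hence by L^p norms. This turns the L^p Bernstein inequalities into pointwise ones. -/
theorem enorm_le_eLpNorm_add_eLpNorm {p : ℝ≥0∞} (hp : 1 ≤ p) {w w' : ℝ → ℂ}
    (hw : ∀ t, HasDerivAt w (w' t) t) (hc : Continuous w') (t : ℝ) :
    ‖w t‖ₑ ≤ eLpNorm w p volume + eLpNorm w' p volume := by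
  have hwc : Continuous w := continuous_iff_continuousAt.mpr fun t => (hw t).continuousAt
  have hprob : IsProbabilityMeasure (volume.restrict (Ioc t (t + 1))) := ⟨by simp⟩
  have hle : ∀ z : ℝ → ℂ, Continuous z →
      ∫⁻ s in Ioc t (t + 1), ‖z s‖ₑ ≤ eLpNorm z p volume := fun z hz => by
    rw [← eLpNorm_one_eq_lintegral_enorm]
    exact (eLpNorm_le_eLpNorm_of_exponent_le hp hz.aestronglyMeasurable).trans
      (eLpNorm_mono_measure _ Measure.restrict_le_self)
  have hpt : ∀ s ∈ Ioc t (t + 1), ‖w t‖ₑ ≤ ‖w s‖ₑ + ∫⁻ x in Ioc t (t + 1), ‖w' x‖ₑ := by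
    intro s hs
    have h1 : w t = w s - ∫ x in t..s, w' x := by
      rw [intervalIntegral.integral_eq_sub_of_hasDerivAt (fun x _ => hw x)
        (hc.intervalIntegrable _ _)]
      ring
    rw [h1]
    refine enorm_sub_le.trans ?_
    gcongr
    rw [intervalIntegral.integral_of_le hs.1.le]
    refine (enorm_integral_le_lintegral_enorm _).trans ?_
    exact lintegral_mono_set (Ioc_subset_Ioc_right hs.2)
  calc ‖w t‖ₑ = ∫⁻ _ in Ioc t (t + 1), ‖w t‖ₑ := by simp
    _ ≤ ∫⁻ s in Ioc t (t + 1), (‖w s‖ₑ + ∫⁻ x in Ioc t (t + 1), ‖w' x‖ₑ) :=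
      setLIntegral_mono' measurableSet_Ioc hpt
    _ = (∫⁻ s in Ioc t (t + 1), ‖w s‖ₑ) + ∫⁻ x in Ioc t (t + 1), ‖w' x‖ₑ := by
      rw [lintegral_add_right _ measurable_const]; simp
    _ ≤ _ := add_le_add (hle w hwc) (hle w' hc)

/-- A function of the Bernstein space is, in the logarithmic variable, almost everywhere equal to
a smooth function whose derivatives are bounded by multiples of `σ ^ k`. -/
theorem exists_derivGrowth_of_mem_bernstein {σ p : ℝ} (hσ : 0 < σ) (hp : 1 < p) {f : ℝ → ℂ}
    (hf : f ∈ bernstein σ p) :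
    ∃ (h : ℝ → ℂ) (M : ℝ), DerivGrowth h M σ 0 (fun _ => 1) ∧
      h =ᵐ[volume] fun t => f (Real.exp t) := by
  obtain ⟨g, hg0, hg, hbound⟩ := hf
  have hp0 : 0 < p := by linarith
  have hp1 : 1 ≤ ENNReal.ofReal p := by simpa using hp.le
  have hprim : ∀ k, ∃ w : ℝ → ℂ, w =ᵐ[volume] (fun t => g k (Real.exp t)) ∧
      ∃ a, ∀ b, w b = w a + ∫ x in a..b, g (k + 1) (Real.exp x) := fun k => by
    obtain ⟨h1, h2, h3⟩ := hg k
    refine exists_primitive_of_tendsto_eLpNorm hp1 (h1.memLp_comp_exp hp0)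
      (h2.memLp_comp_exp hp0) (h3.congr fun t => ?_)
    rw [xNorm_eq_eLpNorm hp0]
    simp only [translate, Real.exp_add]
  choose w hwae a hw using hprim
  have hloc : ∀ k, LocallyIntegrable (fun t => g k (Real.exp t)) volume := fun k =>
    ((hg k).1.memLp_comp_exp hp0).locallyIntegrable hp1
  have hcont : ∀ k, Continuous (w k) := fun k => by
    have : w k = fun b => w k (a k) + ∫ x in (a k)..b, g (k + 1) (Real.exp x) := funext (hw k)
    rw [this]
    exact continuous_const.add (intervalIntegral.continuous_primitive
      (intervalIntegrable_of_locallyIntegrable (hloc (k + 1))) _)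
  -- The integrand may be replaced by its continuous representative `w (k + 1)`, so the fundamental
  -- theorem applies at every point.
  have hderiv : ∀ k t, HasDerivAt (w k) (w (k + 1) t) t := fun k t => by
    have : w k = fun b => w k (a k) + ∫ x in (a k)..b, w (k + 1) x := funext fun b => by
      rw [hw k b]
      congr 1
      exact intervalIntegral.integral_congr_ae
        ((hwae (k + 1)).mono fun x hx _ => hx.symm)
    rw [this]
    exact (intervalIntegral.integral_hasDerivAt_right ((hcont (k + 1)).intervalIntegrable _ _)
      ((hcont (k + 1)).stronglyMeasurableAtFilter _ _) (hcont (k + 1)).continuousAt).const_add _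
  have hN : xNorm p f ≠ ⊤ := by rw [← hg0]; exact (hg 0).1.2.ne
  have hnorm : ∀ k, eLpNorm (w k) (ENNReal.ofReal p) volume
      ≤ ENNReal.ofReal (σ ^ k) * xNorm p f := fun k => by
    rw [eLpNorm_congr_ae (hwae k), ← xNorm_eq_eLpNorm hp0]
    exact hbound k
  -- The factor 1 + σ comes from σ^k + σ^(k+1), the bounds for `w k` and its derivative.
  refine ⟨w 0, (1 + σ) * (xNorm p f).toReal, ⟨contDiff_of_hasDerivAt hderiv, fun k t => ?_⟩, ?_⟩
  · rw [iteratedDeriv_eq_of_hasDerivAt hderiv]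
    have h1 : ‖w k t‖ₑ ≤ ENNReal.ofReal ((σ ^ k + σ ^ (k + 1)) * (xNorm p f).toReal) := by
      refine (enorm_le_eLpNorm_add_eLpNorm hp1 (hderiv k) (hcont (k + 1)) t).trans ?_
      refine (add_le_add (hnorm k) (hnorm (k + 1))).trans_eq ?_
      rw [← add_mul, ← ENNReal.ofReal_add (by positivity) (by positivity),
        ENNReal.ofReal_mul (by positivity), ENNReal.ofReal_toReal hN]
    rw [← ofReal_norm, ENNReal.ofReal_le_ofReal_iff (by positivity)] at h1
    refine h1.trans_eq ?_
    rw [pow_succ]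
    ring
  · rw [← hg0]; exact hwae 0

/-! ### Return to the half-line -/

theorem vtTerm_eq {σ : ℝ} (hσ : 0 < σ) {F h : ℝ → ℂ} (hF : ∀ t, F (Real.exp t) = h t)
    (k : {k : ℤ // k ≠ 0}) (τ : ℝ) :
    vtTerm σ F k τ = (samplingCoeff (σ / Real.pi * Real.log τ) k : ℂ) *
      h (Real.pi / σ * ((k : ℤ) : ℝ)) := by
  have hk : ((k : ℤ) : ℝ) ≠ 0 := by exact_mod_cast k.2
  rw [vtTerm, hF, samplingCoeff, if_neg k.2, mul_comm]
  congr 2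
  · field_simp
  · ring

/-- A majorant independent of τ as long as |(σ/π) ln τ| ≤ R, for the Weierstrass M-test on compact
sets. -/
theorem norm_vtTerm_le {σ : ℝ} (hσ : 0 < σ) {F h : ℝ → ℂ} (hF : ∀ t, F (Real.exp t) = h t)
    {M : ℝ} (hM : ∀ t, ‖h t‖ ≤ M) {τ R : ℝ} (hR : |σ / Real.pi * Real.log τ| ≤ R)
    (k : {k : ℤ // k ≠ 0}) :
    ‖vtTerm σ F k τ‖ ≤ R * (1 + R) * (1 / ((k : ℤ) : ℝ) ^ 2) * M := by
  have hk : ((k : ℤ) : ℝ) ≠ 0 := by exact_mod_cast k.2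
  have hR0 : 0 ≤ R := (abs_nonneg _).trans hR
  rw [vtTerm_eq hσ hF, norm_mul, Complex.norm_real, Real.norm_eq_abs, samplingCoeff, if_neg k.2]
  refine mul_le_mul ((abs_div_mul_nsinc_sub_le _ hk).trans ?_) (hM _) (norm_nonneg _)
    (by positivity)
  gcongr

theorem tsum_eq_add_tsum_ne_zero {c : ℤ → ℂ} {s : ℂ} (hc : HasSum c s) :
    s = c 0 + ∑' k : {k : ℤ // k ≠ 0}, c k := by
  have h := tsum_subtype {k : ℤ | k ≠ 0} c
  rw [← hc.tsum_eq, hc.summable.tsum_eq_add_tsum_ite 0]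
  congr 1
  refine Eq.trans (tsum_congr fun k => ?_) h.symm
  by_cases hk : k = 0 <;> simp [hk]

end Mellin

end


theorem mainTheorem4 (σ p : ℝ) (hσ : 0 < σ) (hp : 1 < p) (f : ℝ → ℂ)
    (hf : f ∈ Mellin.bernstein σ p) :
    (∃ F : ℝ → ℂ, ContinuousOn F (Ioi 0) ∧ F =ᵐ[Mellin.halfLine] f) ∧
    ∀ F : ℝ → ℂ, ContinuousOn F (Ioi 0) → F =ᵐ[Mellin.halfLine] f →
      ContDiffOn ℝ ∞ F (Ioi 0) ∧
      (∀ τ : ℝ, 0 < τ →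
        Summable (fun k => ‖Mellin.vtTerm σ F k τ‖) ∧
        F τ = (Mellin.nsinc (σ / Real.pi * Real.log τ) : ℂ) * F 1
          + ((Real.log τ * Mellin.nsinc (σ / Real.pi * Real.log τ) : ℝ) : ℂ) * deriv F 1
          + ∑' k, Mellin.vtTerm σ F k τ) ∧
      (∀ K : Set ℝ, K ⊆ Ioi 0 → IsCompact K →
        HasSumUniformlyOn (Mellin.vtTerm σ F) (fun τ => ∑' k, Mellin.vtTerm σ F k τ) K ∧
        HasSumUniformlyOn (fun k τ => ‖Mellin.vtTerm σ F k τ‖)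
          (fun τ => ∑' k, ‖Mellin.vtTerm σ F k τ‖) K) := by
  obtain ⟨h, M, hh, hae⟩ := Mellin.exists_derivGrowth_of_mem_bernstein hσ hp hf
  have hhc : Continuous h := hh.contDiff.continuous
  have hlog : ∀ x ∈ Ioi (0 : ℝ), x ≠ 0 := fun x hx => (mem_Ioi.mp hx).ne'
  refine ⟨⟨fun x => h (Real.log x), ?_, ?_⟩, fun F hFc hFf => ?_⟩
  · exact hhc.comp_continuousOn (Real.continuousOn_log.mono hlog)
  · filter_upwards [Mellin.ae_comp_log hae, ae_restrict_mem measurableSet_Ioi] with x hx hx0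
    rw [hx, Real.exp_log hx0]
  -- Continuous functions that agree almost everywhere on the line agree everywhere.
  have hFe : ∀ t, F (Real.exp t) = h t := by
    have hc : Continuous fun t => F (Real.exp t) :=
      hFc.comp_continuous Real.continuous_exp fun t => Real.exp_pos t
    refine congrFun ((hc.ae_eq_iff_eq volume hhc).mp ?_)
    filter_upwards [Mellin.ae_comp_exp hFf, hae] with t h1 h2
    rw [h1, h2]
  have hFl : ∀ x, 0 < x → F x = h (Real.log x) := fun x hx => by rw [← hFe, Real.exp_log hx]
  have hM : ∀ t, ‖h t‖ ≤ M := fun t => by simpa using hh.bound 0 t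
  have hsq : ∀ R : ℝ, Summable fun k : {k : ℤ // k ≠ 0} =>
      R * (1 + R) * (1 / ((k : ℤ) : ℝ) ^ 2) * M := fun R =>
    ((((Real.summable_one_div_int_pow (p := 2)).mpr one_lt_two).subtype _).mul_left _).mul_right _
  refine ⟨?_, fun τ hτ => ⟨?_, ?_⟩, fun K hK hKc => ?_⟩
  · exact (hh.contDiff.comp_contDiffOn (Real.contDiffOn_log.mono hlog)).congr
      fun x hx => hFl x hx
  · exact Summable.of_nonneg_of_le (fun _ => norm_nonneg _)
      (Mellin.norm_vtTerm_le hσ hFe hM le_rfl) (hsq _)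
  · have hv := hh.comp_const_mul (div_pos Real.pi_pos hσ).le
    rw [div_mul_cancel₀ _ hσ.ne'] at hv
    have hs := Mellin.hasSum_samplingCoeff hv (σ / Real.pi * Real.log τ)
    have hd : deriv (fun t => h (Real.pi / σ * t)) 0 = (Real.pi / σ : ℝ) * deriv h 0 := by
      rw [deriv_comp_mul_left, mul_zero, Complex.real_smul]
    have hd1 : deriv F 1 = deriv h 0 := by
      have he : F =ᶠ[𝓝 1] fun x => h (Real.log x) := by
        filter_upwards [Ioi_mem_nhds zero_lt_one] with x hx using hFl x hx
      have hh1 : HasDerivAt h (deriv h 0) (Real.log 1) := by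
        rw [Real.log_one]
        exact (hh.contDiff.differentiable (by simp) 0).hasDerivAt
      have hcomp := HasDerivAt.scomp (1 : ℝ) hh1 (Real.hasDerivAt_log one_ne_zero)
      rw [he.deriv_eq]
      simpa [Function.comp_def] using hcomp.deriv
    have hsplit := Mellin.tsum_eq_add_tsum_ne_zero hs
    have hterm : ∀ k : {k : ℤ // k ≠ 0}, Mellin.vtTerm σ F k τ = _ :=
      fun k => Mellin.vtTerm_eq hσ hFe k τ
    have hF1 : F 1 = h 0 := by rw [hFl 1 one_pos, Real.log_one]
    have hz : Real.pi / σ * (σ / Real.pi * Real.log τ) = Real.log τ := by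
      field_simp
    rw [hd, hz] at hsplit
    rw [hFl τ hτ, hF1, hd1, tsum_congr hterm, sub_eq_iff_eq_add.mp hsplit]
    simp only [Mellin.samplingCoeff, if_true, Int.cast_zero, mul_zero]
    -- The factor π/σ from differentiating the dilated function turns (σ/π) ln τ back into ln τ.
    have hcoef : ((Real.log τ * Mellin.nsinc (σ / Real.pi * Real.log τ) : ℝ) : ℂ) =
        ((σ / Real.pi * Real.log τ * Mellin.nsinc (σ / Real.pi * Real.log τ) : ℝ) : ℂ) *
          ((Real.pi / σ : ℝ) : ℂ) := by
      rw [← Complex.ofReal_mul]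
      congr 1
      field_simp
    rw [hcoef]
    ring
  · obtain ⟨R, hR⟩ := hKc.exists_bound_of_continuousOn
      (f := fun τ => σ / Real.pi * Real.log τ)
      (continuousOn_const.mul (Real.continuousOn_log.mono fun x hx => hlog x (hK hx)))
    have hb := fun (k : {k : ℤ // k ≠ 0}) (τ : ℝ) (hτ : τ ∈ K) =>
      Mellin.norm_vtTerm_le hσ hFe hM (hR τ hτ) k
    exact ⟨HasSumUniformlyOn.of_norm_le_summable (hsq R) hb,
      HasSumUniformlyOn.of_norm_le_summable (hsq R) fun k τ hτ => by
        rw [norm_norm]; exact hb k τ hτ⟩
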